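/- Let $n,m\in\mathbb{N}$ and let $f:\mathbb{R}^n\times\mathbb{R}^m\to\mathbb{R}^n$ be continuous and locally Lipschitz in the first variable, uniformly for the second variable in bounded sets: for every $x_0\in\mathbb{R}^n$ and $R>0$ there are a neighbourhood $N$ of $x_0$ and $L\ge 0$ such that $|f(x,v)-f(y,v)|\le L|x-y|$ for all $x,y\in N$ and all $v\in\mathbb{R}^m$ with $|v|\le R$. (Here $|\cdot|$ is the Euclidean norm.) Let $\mathcal U:=L_\infty(\mathbb{R}_+,\mathbb{R}^m)$ with the essential supremum norm $\|\cdot\|_\infty$. Assume that the system $\dot x=f(x,u)$ is forward complete, i.e. for every $y\in\mathbb{R}^n$ and $u\in\mathcal U$ the initial value problem $\dot x(t)=f(x(t),u(t))$, $x(0)=y$, has a (necessarily unique) Carathéodory solution $\phi(\cdot,y,u)$ on $[0,\infty)$: a continuous function with $\phi(t,y,u)=y+\int_0^t f(\phi(s,y,u),u(s))\,ds$ for all $t\ge 0$. Let $\mathcal K$ be the set of continuous, strictly increasing functions $\gamma:\mathbb{R}_+\to\mathbb{R}_+$ with $\gamma(0)=0$. Then the following two properties are equivalent. (LIM) There is $\gamma\in\mathcal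 K\cup\{0\}$ such that for all $x\in\mathbb{R}^n$, $u\in\mathcal U$ and $\varepsilon>0$ there is $t\ge 0$ with $|\phi(t,x,u)|\le\varepsilon+\gamma(\|u\|_\infty)$. (ULIM) There is $\gamma\in\mathcal K\cup\{0\}$ such that for every $\varepsilon>0$ and every $r>0$ there is $\tau=\tau(\varepsilon,r)$ such that for all $x\in\mathbb{R}^n$ with $|x|\le r$ and all $u\in\mathcal U$ there is $t\in[0,\tau]$ with $|\phi(t,x,u)|\le\varepsilon+\gamma(\|u\|_\infty)$. -/

import Mathlib

open MeasureTheory Set Topology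
open scoped NNReal ENNReal

/-- Class `𝒦`: continuous, strictly increasing functions `γ : ℝ₊ → ℝ₊` with `γ 0 = 0`. -/
def ClassK (γ : ℝ≥0 → ℝ≥0) : Prop :=
  Continuous γ ∧ StrictMono γ ∧ γ 0 = 0

section LimitProperties

variable {X 𝒰 : Type*} [NormedAddCommGroup X] [NormedAddCommGroup 𝒰]

/-- The limit property (LIM) of a forward complete system with transition map
`φ t x u` (only times `t ≥ 0` matter): there is `γ ∈ 𝒦 ∪ {0}` such that for all `x`, `u` and
`ε > 0` there is a time `t ≥ 0` with `‖φ t x u‖ ≤ ε + γ ‖u‖`. -/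
def HasLIM (φ : ℝ → X → 𝒰 → X) : Prop :=
  ∃ γ : ℝ≥0 → ℝ≥0, (ClassK γ ∨ γ = 0) ∧
    ∀ (x : X) (u : 𝒰) (ε : ℝ), 0 < ε →
      ∃ t : ℝ, 0 ≤ t ∧ ‖φ t x u‖ ≤ ε + (γ ‖u‖₊ : ℝ)

/-- The uniform limit property (ULIM): there is `γ ∈ 𝒦 ∪ {0}` such that for all `ε, r > 0` there
is `τ` such that for all `‖x‖ ≤ r` and all `u` there is `t ∈ [0, τ]` with
`‖φ t x u‖ ≤ ε + γ ‖u‖`. -/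
def HasULIM (φ : ℝ → X → 𝒰 → X) : Prop :=
  ∃ γ : ℝ≥0 → ℝ≥0, (ClassK γ ∨ γ = 0) ∧
    ∀ (ε r : ℝ), 0 < ε → 0 < r →
      ∃ τ : ℝ, ∀ (x : X), ‖x‖ ≤ r → ∀ u : 𝒰,
        ∃ t : ℝ, 0 ≤ t ∧ t ≤ τ ∧ ‖φ t x u‖ ≤ ε + (γ ‖u‖₊ : ℝ)

end LimitProperties

/-- The input space `L_∞(ℝ₊, ℝᵐ)` with the essential supremum norm. -/
abbrev InputSpace (m : ℕ) : Type :=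
  Lp (EuclideanSpace ℝ (Fin m)) ∞ (volume.restrict (Ici (0 : ℝ)))

section ODE

variable {n m : ℕ}

/-- `f(x, v)` is locally Lipschitz in `x`, uniformly for `v` in bounded sets. -/
def LocallyLipschitzInState
    (f : EuclideanSpace ℝ (Fin n) → EuclideanSpace ℝ (Fin m) → EuclideanSpace ℝ (Fin n)) :
    Prop :=
  ∀ (x₀ : EuclideanSpace ℝ (Fin n)) (R : ℝ), ∃ L : ℝ≥0, ∃ N ∈ 𝓝 x₀,
    ∀ v : EuclideanSpace ℝ (Fin m), ‖v‖ ≤ R → LipschitzOnWith L (fun x => f x v) N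

/-- `x` is a (Carathéodory) solution on `[0, ∞)` of `ẋ = f(x, u)`, `x(0) = y`. Integrals over
`[0, t]` do not depend on the representative of `u`. -/
def IsSolution
    (f : EuclideanSpace ℝ (Fin n) → EuclideanSpace ℝ (Fin m) → EuclideanSpace ℝ (Fin n))
    (y : EuclideanSpace ℝ (Fin n)) (u : InputSpace m) (x : ℝ → EuclideanSpace ℝ (Fin n)) :
    Prop :=
  ContinuousOn x (Ici 0) ∧
    ∀ t : ℝ, 0 ≤ t →
      IntervalIntegrable (fun s => f (x s) (u s)) volume 0 t ∧
        x t = y + ∫ s in (0 : ℝ)..t, f (x s) (u s)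

/-- Forward completeness: for every initial state and every input there is a solution on
`[0, ∞)`. -/
def ForwardComplete
    (f : EuclideanSpace ℝ (Fin n) → EuclideanSpace ℝ (Fin m) → EuclideanSpace ℝ (Fin n)) :
    Prop :=
  ∀ (y : EuclideanSpace ℝ (Fin n)) (u : InputSpace m), ∃ x, IsSolution f y u x

/-- The transition map `φ(t, y, u)`: the value at time `t ≥ 0` of the solution of `ẋ = f(x, u)`,
`x(0) = y`. (The solution is unique on `[0, ∞)` when `f` is continuous and locally Lipschitz in
the state.) -/
noncomputable def transitionMap
    {f : EuclideanSpace ℝ (Fin n) → EuclideanSpace ℝ (Fin m) → EuclideanSpace ℝ (Fin n)}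
    (hf : ForwardComplete f) (t : ℝ) (y : EuclideanSpace ℝ (Fin n)) (u : InputSpace m) :
    EuclideanSpace ℝ (Fin n) :=
  (hf y u).choose t

end ODE

/-! If ULIM fails for the gain `γ + id`, there are trajectories from a fixed ball, with bounded
inputs, that stay large on `[0, k]` for every `k`. A single trajectory that stays large forever
contradicts LIM. Weak limits of the inputs are of no use, since `f` is not assumed affine in the
input; the inputs are concatenated instead.

By compactness, a subsequence of the states converges at all grid times. Following a different
member on each grid interval therefore gives a path with jumps as small as desired
(`exists_selection`). The jumps are repaired by shadowing (`exists_solvesOn_of_weight`): a solution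
near the path is found by a contraction that integrates from the future, with a weight decaying fast
enough to beat the growth of the Lipschitz constants (`exists_weight`). The initial state is not
prescribed, which is harmless because LIM concerns all states.

All this needs the sequence to be bounded on each finite time interval. That is
`ForwardComplete.bounded_reachability`, proved by the same shadowing on a grid accumulating at the
first time where uniform bounds fail. -/

/-! ### Integral solutions: uniqueness and local bounds. -/

section Caratheodory

open Metric Filter

variable {E V : Type*} [NormedAddCommGroup E]

/-- `x` satisfies the integral equation of `ẋ = f(x, w)` at the times in `J`. -/
def SolvesOn [NormedSpace ℝ E] (f : E → V → E) (w : ℝ → V) (x : ℝ → E) (J : Set ℝ) : Prop :=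
  ∀ t ∈ J, IntervalIntegrable (fun s => f (x s) (w s)) volume 0 t ∧
    x t = x 0 + ∫ s in (0 : ℝ)..t, f (x s) (w s)

namespace SolvesOn

variable [NormedSpace ℝ E] {f : E → V → E} {w : ℝ → V} {x y : ℝ → E} {J J' : Set ℝ}

theorem mono (h : SolvesOn f w x J) (hJ : J' ⊆ J) : SolvesOn f w x J' :=
  fun t ht => h t (hJ ht)

theorem sub_eq (h : SolvesOn f w x J) {a b : ℝ} (ha : a ∈ J) (hb : b ∈ J) :
    x b - x a = ∫ s in a..b, f (x s) (w s) := by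
  rw [(h a ha).2, (h b hb).2, ← intervalIntegral.integral_interval_sub_left (h b hb).1 (h a ha).1]
  abel

theorem continuousOn {T : ℝ} (h : SolvesOn f w x (Icc 0 T)) : ContinuousOn x (Icc 0 T) := by
  rcases lt_or_ge T 0 with hT | hT
  · simp [Icc_eq_empty (not_le.2 hT)]
  have hi : IntegrableOn (fun s => f (x s) (w s)) (uIcc 0 T) volume := by
    have := (h T ⟨hT, le_rfl⟩).1
    rw [uIcc_of_le hT]
    exact (intervalIntegrable_iff_integrableOn_Icc_of_le hT).1 this
  have hc := intervalIntegral.continuousOn_primitive_interval hi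
  rw [uIcc_of_le hT] at hc
  exact (continuousOn_const.add hc).congr fun t ht => (h t ht).2

theorem norm_sub_le (h : SolvesOn f w x J) {a b C : ℝ} (ha : a ∈ J) (hb : b ∈ J) (hab : a ≤ b)
    (hC : ∀ s ∈ Ioo a b, ‖f (x s) (w s)‖ ≤ C) : ‖x b - x a‖ ≤ C * (b - a) := by
  rw [h.sub_eq ha hb]
  have : ‖∫ s in a..b, f (x s) (w s)‖ ≤ C * |b - a| := by
    refine intervalIntegral.norm_integral_le_of_norm_le_const_ae ?_
    filter_upwards [Measure.ae_ne volume b] with s hs hs'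
    rw [uIoc_of_le hab] at hs'
    exact hC s ⟨hs'.1, lt_of_le_of_ne hs'.2 hs⟩
  rwa [abs_of_nonneg (sub_nonneg.2 hab)] at this

end SolvesOn

variable [NormedAddCommGroup V]

/-- `f(·, v)` is Lipschitz on every ball, uniformly for `v` in bounded sets. -/
def LipschitzOnBalls (f : E → V → E) : Prop :=
  ∀ M R : ℝ, ∃ L : ℝ≥0, ∀ v : V, ‖v‖ ≤ R → LipschitzOnWith L (fun x => f x v) (closedBall 0 M)

/-- The map `x ↦ f x ·` into continuous functions on a closed ball of inputs, with the sup norm, is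
locally Lipschitz, hence Lipschitz on compact sets. The sup norm makes the constant uniform in `v`.
-/
theorem lipschitzOnBalls_of_locally [ProperSpace E] [ProperSpace V] {f : E → V → E}
    (hcont : Continuous (Function.uncurry f))
    (hlip : ∀ (x₀ : E) (R : ℝ), ∃ L : ℝ≥0, ∃ N ∈ 𝓝 x₀,
      ∀ v : V, ‖v‖ ≤ R → LipschitzOnWith L (fun x => f x v) N) : LipschitzOnBalls f := by
  intro M R
  have : CompactSpace (closedBall (0 : V) R) :=
    isCompact_iff_compactSpace.1 (isCompact_closedBall _ _)
  let Φ : E → C(closedBall (0 : V) R, E) := fun x =>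
    ⟨fun v => f x v, hcont.comp (continuous_const.prodMk continuous_subtype_val)⟩
  have hΦ : LocallyLipschitzOn (closedBall (0 : E) M) Φ := by
    intro x _
    obtain ⟨L, N, hN, h⟩ := hlip x R
    refine ⟨L, N, mem_nhdsWithin_of_mem_nhds hN, LipschitzOnWith.of_dist_le_mul ?_⟩
    intro p hp q hq
    refine (ContinuousMap.dist_le (by positivity)).2 fun v => ?_
    exact (h v (mem_closedBall_zero_iff.1 v.2)).dist_le_mul p hp q hq
  obtain ⟨L, hL⟩ := hΦ.exists_lipschitzOnWith_of_compact (isCompact_closedBall _ _)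
  refine ⟨L, fun v hv => LipschitzOnWith.of_dist_le_mul fun p hp q hq => ?_⟩
  exact (ContinuousMap.dist_apply_le_dist (f := Φ p) (g := Φ q) ⟨v, by simpa using hv⟩).trans
    (hL.dist_le_mul p hp q hq)

theorem exists_norm_le_on_balls [ProperSpace E] [ProperSpace V] {f : E → V → E}
    (hcont : Continuous (Function.uncurry f)) (M R : ℝ) :
    ∃ C : ℝ, 0 < C ∧ ∀ x v, ‖x‖ ≤ M → ‖v‖ ≤ R → ‖f x v‖ ≤ C := by
  have hK : IsCompact (closedBall (0 : E) M ×ˢ closedBall (0 : V) R) :=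
    (isCompact_closedBall _ _).prod (isCompact_closedBall _ _)
  obtain ⟨C, hC⟩ := hK.exists_bound_of_continuousOn hcont.continuousOn
  refine ⟨max C 1, by positivity, fun x v hx hv => ?_⟩
  exact (hC (x, v) ⟨by simpa using hx, by simpa using hv⟩).trans (le_max_left _ _)

namespace SolvesOn

variable [NormedSpace ℝ E] {f : E → V → E} {w : ℝ → V} {x y : ℝ → E}

theorem eqOn [ProperSpace E] {T R : ℝ} (hf : LipschitzOnBalls f) (hw : ∀ s, ‖w s‖ ≤ R)
    (hx : SolvesOn f w x (Icc 0 T)) (hy : SolvesOn f w y (Icc 0 T)) (h0 : x 0 = y 0) :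
    EqOn x y (Icc 0 T) := by
  intro t ht
  have hT : 0 ≤ T := ht.1.trans ht.2
  have hxc := hx.continuousOn
  have hyc := hy.continuousOn
  obtain ⟨M₁, hM₁⟩ := isCompact_Icc.exists_bound_of_continuousOn hxc
  obtain ⟨M₂, hM₂⟩ := isCompact_Icc.exists_bound_of_continuousOn hyc
  obtain ⟨L, hL⟩ := hf (max M₁ M₂) R
  -- extend `‖x - y‖` to a continuous function on the line
  let g : ℝ → ℝ := IccExtend hT ((Icc 0 T).domRestrict fun s => ‖x s - y s‖)
  have hg : Continuous g := (continuousOn_iff_continuous_domRestrict.1 (hxc.sub hyc).norm).Icc_extend'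
  have hge : ∀ s ∈ Icc 0 T, g s = ‖x s - y s‖ := fun s hs => by
    exact IccExtend_of_mem hT _ hs
  have hbound : ∀ s ∈ Icc 0 T, g s ≤ L * ∫ r in (0 : ℝ)..s, g r := by
    intro s hs
    rw [hge s hs, (hx s hs).2, (hy s hs).2, h0, add_sub_add_left_eq_sub,
      ← intervalIntegral.integral_sub (hx s hs).1 (hy s hs).1, ← intervalIntegral.integral_const_mul]
    refine intervalIntegral.norm_integral_le_of_norm_le hs.1 (ae_of_all _ fun r hr => ?_)
      ((hg.const_mul _).intervalIntegrable _ _)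
    have hr' : r ∈ Icc 0 T := ⟨hr.1.le, hr.2.trans hs.2⟩
    rw [hge r hr', ← dist_eq_norm, ← dist_eq_norm]
    refine (hL (w r) (hw r)).dist_le_mul _ ?_ _ ?_
    · simpa using Or.inl (hM₁ r hr')
    · simpa using Or.inr (hM₂ r hr')
  have hF : ∀ s, HasDerivAt (fun s => ∫ r in (0 : ℝ)..s, g r) (g s) s := fun s =>
    hg.deriv_integral g 0 s ▸ (intervalIntegral.differentiable_integral_of_continuous hg s).hasDerivAt
  have hg0 : ∀ s, 0 ≤ g s := fun s => norm_nonneg _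
  -- Gronwall is applied to the primitive of `g`, because `g` itself need not be differentiable.
  have hgr := norm_le_gronwallBound_of_norm_deriv_right_le (a := 0) (b := T) (δ := 0) (K := L) (ε := 0)
    (f := fun s => ∫ r in (0 : ℝ)..s, g r) (f' := g)
    (fun s _ => (hF s).continuousAt.continuousWithinAt)
    (fun s _ => (hF s).hasDerivWithinAt) (by simp) (fun s hs => by
      rw [Real.norm_of_nonneg (hg0 s), add_zero]
      refine (hbound s ⟨hs.1, hs.2.le⟩).trans ?_
      gcongr
      exact Real.le_norm_self _) t ht
  rw [gronwallBound_ε0_δ0] at hgr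
  have h1 := hbound t ht
  rw [norm_le_zero_iff.1 hgr, mul_zero, hge t ht] at h1
  exact sub_eq_zero.1 (norm_le_zero_iff.1 h1)

/-- A trajectory of norm at most `M` stays of norm at most `M + 1` for a uniform time. -/
theorem exists_norm_le_add_one [ProperSpace E] [ProperSpace V]
    (hcont : Continuous (Function.uncurry f)) (M R : ℝ) :
    ∃ δ : ℝ, 0 < δ ∧ ∀ (w : ℝ → V) (x : ℝ → E), (∀ s, ‖w s‖ ≤ R) → SolvesOn f w x (Ici 0) →
      ∀ a, 0 ≤ a → ‖x a‖ ≤ M → ∀ t ∈ Icc a (a + δ), ‖x t‖ ≤ M + 1 := by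
  obtain ⟨C, hC, hCb⟩ := exists_norm_le_on_balls hcont (M + 1) R
  -- At speed at most `C` this time allows a displacement of `1 / 2`, too little to reach norm `M +
  -- 1`; `b` below is the first time that norm would be attained.
  refine ⟨1 / (2 * C), by positivity, fun w x hw hx a ha hxa t ht => ?_⟩
  by_contra! hlt
  have hxc : ContinuousOn x (Icc a t) :=
    ((hx.mono Icc_subset_Ici_self).continuousOn (T := t)).mono (Icc_subset_Icc_left ha)
  have hcl : IsCompact (Icc a t ∩ (fun s => ‖x s‖) ⁻¹' Ici (M + 1)) :=
    isCompact_Icc.of_isClosed_subset (hxc.norm.preimage_isClosed_of_isClosed isClosed_Icc isClosed_Ici)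
      inter_subset_left
  obtain ⟨b, ⟨hb, hbM⟩, hbl⟩ := hcl.exists_isLeast ⟨t, ⟨ht.1, le_rfl⟩, hlt.le⟩
  have h1 : ‖x b - x a‖ ≤ C * (b - a) := by
    refine hx.norm_sub_le ha (ha.trans hb.1) hb.1 fun s hs => hCb _ _ ?_ (hw s)
    by_contra! hs'
    exact absurd (hbl ⟨⟨hs.1.le, hs.2.le.trans hb.2⟩, hs'.le⟩) (not_le.2 hs.2)
  have h2 : C * (b - a) ≤ C * (1 / (2 * C)) := by
    gcongr
    linarith [hb.2, ht.2]
  have h3 : C * (1 / (2 * C)) = 1 / 2 := by field_simp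
  have h4 : ‖x b‖ ≤ ‖x b - x a‖ + ‖x a‖ := by simpa using norm_add_le (x b - x a) (x a)
  have h5 : M + 1 ≤ ‖x b‖ := hbM
  linarith

end SolvesOn

end Caratheodory

/-! ### Backward shadowing by a weighted contraction. -/

section Shadowing

open Metric Filter

variable {E V : Type*} [NormedAddCommGroup E] [NormedAddCommGroup V] [NormedSpace ℝ E]
  [CompleteSpace E] [MeasurableSpace E] [BorelSpace E] [SecondCountableTopology E]
  [MeasurableSpace V] [BorelSpace V] [SecondCountableTopology V]

theorem continuous_setIntegral_Ioi {F : Type*} [NormedAddCommGroup F] [NormedSpace ℝ F]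
    {μ : Measure ℝ} [NullSingletonClass μ] {z : ℝ → F} (hz : Integrable z μ) :
    Continuous fun t => ∫ s in Ioi t, z s ∂μ := by
  have h : (fun t => ∫ s in Ioi t, z s ∂μ) =
      fun t => (∫ s in Ioi (0 : ℝ), z s ∂μ) - ∫ s in (0 : ℝ)..t, z s ∂μ := by
    funext t
    rcases le_total 0 t with ht | ht
    · rw [← intervalIntegral.integral_Ioi_sub_Ioi hz.integrableOn ht]; abel
    · rw [intervalIntegral.integral_symm,
        ← intervalIntegral.integral_Ioi_sub_Ioi hz.integrableOn ht]; abel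
  rw [h]
  exact continuous_const.sub
    (intervalIntegral.continuous_primitive (fun _ _ => hz.intervalIntegrable) 0)

/-- Backward shadowing: if `G` is a primitive of `f(D, w)` which approximates `D` up to half of a
weight `ρ` that decays fast enough with respect to the Lipschitz constants `ℓ` of `f(·, w)` around
`D`, there is a solution of `ẏ = f(y, w)` that is `ρ`-close to `D`. -/
theorem exists_solvesOn_of_weight {f : E → V → E} (hcont : Continuous (Function.uncurry f))
    {J : Set ℝ} (hJ : MeasurableSet J) (hJI : ∀ t ∈ J, 0 ≤ t ∧ Icc 0 t ⊆ J)
    {w : ℝ → V} {D G : ℝ → E} (hw : Measurable w) (hD : Measurable D) (hG : Measurable G)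
    {ℓ ρ : ℝ → ℝ} (hℓ : ∀ t ∈ J, 0 ≤ ℓ t) (hρ0 : ∀ t ∈ J, 0 ≤ ρ t) (hρ1 : ∀ t ∈ J, ρ t ≤ 1)
    (hint : Integrable (fun s => ℓ s * ρ s) (volume.restrict J))
    (htail : ∀ t ∈ J, ∫ s in Ioi t, ℓ s * ρ s ∂(volume.restrict J) ≤ ρ t / 2)
    (hlip : ∀ s ∈ J, ∀ p ∈ closedBall (D s) 1, ∀ q ∈ closedBall (D s) 1,
      ‖f p (w s) - f q (w s)‖ ≤ ℓ s * ‖p - q‖)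
    (hGD : ∀ t ∈ J, ‖G t - D t‖ ≤ ρ t / 2)
    (hGi : ∀ t ∈ J, IntervalIntegrable (fun s => f (D s) (w s)) volume 0 t ∧
      G t = G 0 + ∫ s in (0 : ℝ)..t, f (D s) (w s)) :
    ∃ y : ℝ → E, (∀ t ∈ J, ‖y t - D t‖ ≤ ρ t) ∧ SolvesOn f w y J := by
  set μ := volume.restrict J with hμ
  have hJμ : ∀ᵐ s ∂μ, s ∈ J := ae_restrict_mem hJ
  let Z : (ℝ → E) → ℝ → E := fun y s => f (y s) (w s) - f (D s) (w s)
  -- A fixed point solves the equation, since `G` is a primitive of `f(D, w)`. Integrating over the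
  -- future lets the decay of `ρ` control the integral, at the price of leaving `y 0` free.
  let Φ : (ℝ → E) → ℝ → E := fun y t => G t - ∫ s in Ioi t, Z y s ∂μ
  let Adm : (ℝ → E) → Prop := fun y => AEStronglyMeasurable y μ ∧ ∀ t ∈ J, ‖y t - D t‖ ≤ ρ t
  have hmeas : ∀ y, AEStronglyMeasurable y μ → AEStronglyMeasurable (Z y) μ := fun y hy =>
    (hcont.comp_aestronglyMeasurable (hy.prodMk hw.aestronglyMeasurable)).sub
      (hcont.comp_aestronglyMeasurable (hD.aestronglyMeasurable.prodMk hw.aestronglyMeasurable))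
  have hdiff : ∀ y y', Adm y → Adm y' → ∀ s ∈ J,
      ‖Z y s - Z y' s‖ ≤ ℓ s * ‖y s - y' s‖ := by
    intro y y' hy hy' s hs
    simp only [Z, sub_sub_sub_cancel_right]
    exact hlip s hs _ (by simpa [dist_eq_norm] using (hy.2 s hs).trans (hρ1 s hs)) _
      (by simpa [dist_eq_norm] using (hy'.2 s hs).trans (hρ1 s hs))
  have hAdmD : Adm D := ⟨hD.aestronglyMeasurable, fun t ht => by simpa using hρ0 t ht⟩
  have hZD : Z D = 0 := by funext s; simp [Z]
  have hZb : ∀ y, Adm y → ∀ s ∈ J, ‖Z y s‖ ≤ ℓ s * ρ s := by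
    intro y hy s hs
    have := hdiff y D hy hAdmD s hs
    rw [hZD, Pi.zero_apply, sub_zero] at this
    exact this.trans (mul_le_mul_of_nonneg_left (hy.2 s hs) (hℓ s hs))
  have hZi : ∀ y, Adm y → Integrable (Z y) μ := fun y hy =>
    hint.mono' (hmeas y hy.1) (hJμ.mono fun s hs => hZb y hy s hs)
  have htail' : ∀ (z : ℝ → E) (c : ℝ), 0 ≤ c → (∀ s ∈ J, ‖z s‖ ≤ c * (ℓ s * ρ s)) → ∀ t ∈ J,
      ‖∫ s in Ioi t, z s ∂μ‖ ≤ c * (ρ t / 2) := by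
    intro z c hc hz t ht
    refine (norm_integral_le_of_norm_le ((hint.const_mul c).integrableOn (s := Ioi t))
      (ae_restrict_of_ae (hJμ.mono fun s hs => hz s hs))).trans ?_
    rw [integral_const_mul]
    exact mul_le_mul_of_nonneg_left (htail t ht) hc
  have hΦ : ∀ y, Adm y → Adm (Φ y) := by
    intro y hy
    refine ⟨hG.aestronglyMeasurable.sub (continuous_setIntegral_Ioi (hZi y hy)).aestronglyMeasurable,
      fun t ht => ?_⟩
    have h1 := htail' (Z y) 1 zero_le_one (by simpa using hZb y hy) t ht
    have h2 := norm_sub_le (G t - D t) (∫ s in Ioi t, Z y s ∂μ)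
    have h3 : Φ y t - D t = G t - D t - ∫ s in Ioi t, Z y s ∂μ := by simp only [Φ]; abel
    rw [h3]
    linarith [hGD t ht]
  let Y : ℕ → ℝ → E := fun k => Φ^[k] D
  have hYs : ∀ k, Y (k + 1) = Φ (Y k) := fun k => Function.iterate_succ_apply' Φ k D
  have hY : ∀ k, Adm (Y k) := by
    intro k
    induction k with
    | zero => exact hAdmD
    | succ k ih => rw [hYs]; exact hΦ _ ih
  -- `Φ` contracts by the factor `1 / 2` in the sup norm weighted by `1 / ρ`; this is what `htail`
  -- provides.
  have hstep : ∀ k, ∀ t ∈ J, ‖Y k t - Y (k + 1) t‖ ≤ (1 / 2) ^ k * ρ t := by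
    intro k
    induction k with
    | zero =>
      intro t ht
      rw [norm_sub_rev]
      simpa [Y] using (hΦ D hAdmD).2 t ht
    | succ k ih =>
      intro t ht
      have hsub : Y (k + 1) t - Y (k + 1 + 1) t =
          - ∫ s in Ioi t, (Z (Y k) s - Z (Y (k + 1)) s) ∂μ := by
        rw [integral_sub (hZi _ (hY k)).integrableOn (hZi _ (hY (k + 1))).integrableOn, hYs (k + 1)]
        conv_lhs => rw [hYs k]
        simp only [Φ]
        rw [hYs k]
        abel
      rw [hsub, norm_neg]
      refine (htail' _ ((1 / 2) ^ k) (by positivity) (fun s hs => ?_) t ht).trans (by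
        rw [pow_succ]; apply le_of_eq; ring)
      refine (hdiff _ _ (hY k) (hY (k + 1)) s hs).trans ?_
      rw [mul_left_comm]
      exact mul_le_mul_of_nonneg_left (ih s hs) (hℓ s hs)
  have hlim : ∀ t, ∃ l, t ∈ J → Tendsto (fun k => Y k t) atTop (𝓝 l) := by
    intro t
    by_cases ht : t ∈ J
    · obtain ⟨l, hl⟩ := cauchySeq_tendsto_of_complete
        (cauchySeq_of_le_geometric (1 / 2) (ρ t) (f := fun k => Y k t) (by norm_num) fun k => by
          rw [dist_eq_norm, mul_comm]; exact hstep k t ht)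
      exact ⟨l, fun _ => hl⟩
    · exact ⟨0, fun h => absurd h ht⟩
  choose y hy using hlim
  have hAdm : Adm y := by
    refine ⟨aestronglyMeasurable_of_tendsto_ae atTop (fun k => (hY k).1)
      (hJμ.mono fun s hs => hy s hs), fun t ht => ?_⟩
    exact le_of_tendsto ((hy t ht).sub_const _).norm (Eventually.of_forall fun k => (hY k).2 t ht)
  have hfix : ∀ t ∈ J, y t = Φ y t := by
    intro t ht
    have h1 : Tendsto (fun k => ∫ s in Ioi t, Z (Y k) s ∂μ) atTop (𝓝 (∫ s in Ioi t, Z y s ∂μ)) := by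
      refine tendsto_integral_of_dominated_convergence (fun s => ℓ s * ρ s)
        (fun k => (hmeas _ (hY k).1).restrict) hint.integrableOn
        (fun k => ae_restrict_of_ae (hJμ.mono fun s hs => hZb _ (hY k) s hs))
        (ae_restrict_of_ae (hJμ.mono fun s hs => ?_))
      have : Continuous fun p : E => f p (w s) := hcont.comp (continuous_id.prodMk continuous_const)
      exact ((this.tendsto _).comp (hy s hs)).sub_const _
    refine tendsto_nhds_unique ((tendsto_add_atTop_iff_nat 1).2 (hy t ht)) ?_
    simp only [hYs]
    exact h1.const_sub (G t)
  refine ⟨y, hAdm.2, fun t ht => ?_⟩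
  have h0 : (0 : ℝ) ∈ J := (hJI t ht).2 ⟨le_rfl, (hJI t ht).1⟩
  have hres : μ.restrict (Ioc 0 t) = volume.restrict (Ioc 0 t) :=
    Measure.restrict_restrict_of_subset fun s hs => (hJI t ht).2 ⟨hs.1.le, hs.2⟩
  have hZint : IntervalIntegrable (Z y) volume 0 t := by
    rw [intervalIntegrable_iff_integrableOn_Ioc_of_le (hJI t ht).1, IntegrableOn, ← hres]
    exact (hZi y hAdm).integrableOn
  have hZeq : ∫ s in (0 : ℝ)..t, Z y s ∂μ = ∫ s in (0 : ℝ)..t, Z y s := by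
    rw [intervalIntegral.integral_of_le (hJI t ht).1, intervalIntegral.integral_of_le (hJI t ht).1,
      hres]
  have hsum : (fun s => f (y s) (w s)) = fun s => f (D s) (w s) + Z y s := by
    funext s; simp [Z]
  rw [hsum]
  refine ⟨(hGi t ht).1.add hZint, ?_⟩
  rw [intervalIntegral.integral_add (hGi t ht).1 hZint, ← hZeq,
    ← intervalIntegral.integral_Ioi_sub_Ioi (hZi y hAdm).integrableOn (hJI t ht).1,
    hfix t ht, hfix 0 h0]
  simp only [Φ]
  rw [(hGi t ht).2]
  abel

end Shadowing

/-! ### Weights adapted to the Lipschitz constants. -/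

section Weights

open Metric Filter

/-- The times `s ≥ 0` before the supremum of the grid `t`. -/
def gridTimes (t : ℕ → ℝ) : Set ℝ := Ici 0 ∩ ⋃ j, Iio (t j)

theorem mem_gridTimes {t : ℕ → ℝ} {s : ℝ} : s ∈ gridTimes t ↔ 0 ≤ s ∧ ∃ j, s < t j := by
  simp [gridTimes]

theorem measurableSet_gridTimes (t : ℕ → ℝ) : MeasurableSet (gridTimes t) :=
  measurableSet_Ici.inter (MeasurableSet.iUnion fun _ => measurableSet_Iio)

theorem Icc_subset_gridTimes {t : ℕ → ℝ} {s : ℝ} (hs : s ∈ gridTimes t) :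
    Icc 0 s ⊆ gridTimes t := by
  obtain ⟨_, j, hj⟩ := mem_gridTimes.1 hs
  exact fun r hr => mem_gridTimes.2 ⟨hr.1, j, hr.2.trans_lt hj⟩

/-- The weight `η * exp (-2 ∫ ℓ)` satisfies `ρ' = -2 ℓ ρ`, so integrals of `ℓ ρ` telescope to half
the drop of `ρ`, however fast `ℓ` blows up at the end of the grid. -/
theorem exists_weight {t : ℕ → ℝ} (ht : StrictMono t) (ht0 : t 0 = 0) {ℓ : ℝ → ℝ}
    (hℓc : ContinuousOn ℓ (⋃ j, Iio (t j))) (hℓ : ∀ s, 0 ≤ ℓ s) {η : ℝ} (hη : 0 < η) :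
    ∃ ρ : ℝ → ℝ, (∀ s, 0 < ρ s) ∧ (∀ s ∈ gridTimes t, ρ s ≤ η) ∧ AntitoneOn ρ (gridTimes t) ∧
      Integrable (fun s => ℓ s * ρ s) (volume.restrict (gridTimes t)) ∧
      ∀ s ∈ gridTimes t,
        ∫ r in Ioi s, ℓ r * ρ r ∂(volume.restrict (gridTimes t)) ≤ ρ s / 2 := by
  set I : Set ℝ := ⋃ j, Iio (t j) with hI
  have hIo : IsOpen I := isOpen_iUnion fun _ => isOpen_Iio
  have hIl : ∀ a ∈ I, ∀ b ≤ a, b ∈ I := by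
    intro a ha b hb
    obtain ⟨j, hj⟩ := mem_iUnion.1 ha
    exact mem_iUnion.2 ⟨j, hb.trans_lt hj⟩
  have h0I : (0 : ℝ) ∈ I := mem_iUnion.2 ⟨1, by rw [← ht0]; exact ht zero_lt_one⟩
  have hsub : ∀ a ∈ I, ∀ b ∈ I, uIcc a b ⊆ I := by
    intro a ha b hb r hr
    rcases max_cases a b with h | h
    · exact hIl a ha r (h.1 ▸ hr.2)
    · exact hIl b hb r (h.1 ▸ hr.2)
  have htI : ∀ j, t j ∈ I := fun j => mem_iUnion.2 ⟨j + 1, ht j.lt_succ_self⟩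
  let ρ : ℝ → ℝ := fun s => η * Real.exp (-2 * ∫ r in (0 : ℝ)..s, ℓ r)
  have hρpos : ∀ s, 0 < ρ s := fun s => by positivity
  have hder : ∀ s ∈ I, HasDerivAt ρ (-2 * (ℓ s * ρ s)) s := by
    intro s hs
    have h1 : HasDerivAt (fun u => ∫ r in (0 : ℝ)..u, ℓ r) (ℓ s) s :=
      intervalIntegral.integral_hasDerivAt_right
        ((hℓc.mono (hsub 0 h0I s hs)).intervalIntegrable)
        (hℓc.stronglyMeasurableAtFilter hIo s hs) (hℓc.continuousAt (hIo.mem_nhds hs))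
    have h2 := ((h1.const_mul (-2)).exp).const_mul η
    refine h2.congr_deriv ?_
    simp only [ρ]
    ring
  have hρc : ContinuousOn ρ I := fun s hs => (hder s hs).continuousAt.continuousWithinAt
  have hii : ∀ a ∈ I, ∀ b ∈ I, IntervalIntegrable (fun s => ℓ s * ρ s) volume a b :=
    fun a ha b hb => ((hℓc.mul hρc).mono (hsub a ha b hb)).intervalIntegrable
  have hFTC : ∀ a ∈ I, ∀ b ∈ I, ∫ s in a..b, ℓ s * ρ s = (ρ a - ρ b) / 2 := by
    intro a ha b hb
    have := intervalIntegral.integral_eq_sub_of_hasDerivAt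
      (fun s hs => hder s (hsub a ha b hb hs)) ((hii a ha b hb).const_mul (-2))
    rw [intervalIntegral.integral_const_mul] at this
    linarith
  have hnn : ∀ s, 0 ≤ ℓ s * ρ s := fun s => mul_nonneg (hℓ s) (hρpos s).le
  have hanti : ∀ a ∈ I, ∀ b ∈ I, a ≤ b → ρ b ≤ ρ a := by
    intro a ha b hb hab
    have h1 := hFTC a ha b hb
    have h2 : 0 ≤ ∫ s in a..b, ℓ s * ρ s :=
      intervalIntegral.integral_nonneg hab fun s _ => hnn s
    linarith
  have htailset : ∀ s ∈ gridTimes t, ∀ j, s ≤ t j →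
      ((volume.restrict (gridTimes t)).restrict (Ioi s)).restrict (Iic (t j)) =
        volume.restrict (Ioc s (t j)) := by
    intro s hs j hj
    rw [Measure.restrict_restrict measurableSet_Iic, Measure.restrict_restrict
      (measurableSet_Iic.inter measurableSet_Ioi)]
    congr 1
    ext r
    simp only [mem_inter_iff, mem_Iic, mem_Ioi, mem_Ioc, mem_gridTimes]
    refine ⟨fun h => ⟨h.1.2, h.1.1⟩, fun h => ⟨⟨h.2, h.1⟩, hs.1.trans h.1.le, j + 1, ?_⟩⟩
    exact h.2.trans_lt (ht j.lt_succ_self)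
  -- The tail is exhausted by the sets `Iic (t j)`, on which `ℓ` is harmless; the uniform bound `ρ s
  -- / 2` then gives integrability.
  have hcover : ∀ s, AECover ((volume.restrict (gridTimes t)).restrict (Ioi s)) atTop
      (fun j => Iic (t j)) := by
    intro s
    refine ⟨ae_restrict_of_ae ?_, fun _ => measurableSet_Iic⟩
    filter_upwards [ae_restrict_mem (measurableSet_gridTimes t)] with r hr
    obtain ⟨_, j, hj⟩ := mem_gridTimes.1 hr
    filter_upwards [eventually_ge_atTop j] with i hi
    exact hj.le.trans (ht.monotone hi)
  have hev : ∀ s ∈ gridTimes t, ∀ᶠ j in atTop, s ≤ t j := by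
    intro s hs
    obtain ⟨_, j, hj⟩ := mem_gridTimes.1 hs
    filter_upwards [eventually_ge_atTop j] with i hi
    exact hj.le.trans (ht.monotone hi)
  have hbd : ∀ s ∈ gridTimes t, ∀ j, s ≤ t j →
      ∫ r in Iic (t j), ℓ r * ρ r ∂((volume.restrict (gridTimes t)).restrict (Ioi s)) ≤ ρ s / 2 := by
    intro s hs j hj
    rw [htailset s hs j hj, ← intervalIntegral.integral_of_le hj, hFTC s hs.2 _ (htI j)]
    linarith [hρpos (t j)]
  have hint : ∀ s ∈ gridTimes t,
      Integrable (fun r => ℓ r * ρ r) ((volume.restrict (gridTimes t)).restrict (Ioi s)) := by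
    intro s hs
    refine (hcover s).integrable_of_integral_bounded_of_nonneg_ae (ρ s / 2) (fun j => ?_)
      (ae_of_all _ hnn) ((hev s hs).mono fun j hj => hbd s hs j hj)
    rcases le_total s (t j) with hj | hj
    · rw [IntegrableOn, htailset s hs j hj]
      exact (intervalIntegrable_iff_integrableOn_Ioc_of_le hj).1 (hii s hs.2 _ (htI j))
    · rw [IntegrableOn, Measure.restrict_restrict measurableSet_Iic,
        (disjoint_left.2 fun r (h1 : r ≤ t j) (h2 : s < r) => absurd (h1.trans hj) (not_le.2 h2) :
          Disjoint (Iic (t j)) (Ioi s)).inter_eq]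
      simp
  have h0 : (0 : ℝ) ∈ gridTimes t := ⟨self_mem_Ici, h0I⟩
  refine ⟨ρ, hρpos, fun s hs => ?_, fun a ha b hb hab => hanti a ha.2 b hb.2 hab, ?_,
    fun s hs => ?_⟩
  · simpa [ρ] using hanti 0 h0I s hs.2 hs.1
  · have h1 := hint 0 h0
    rw [← IntegrableOn] at h1
    have h2 : IntegrableOn (fun r => ℓ r * ρ r) (Ici 0) (volume.restrict (gridTimes t)) :=
      (integrableOn_Ici_iff_integrableOn_Ioi).2 h1
    rw [IntegrableOn, Measure.restrict_restrict measurableSet_Ici,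
      inter_eq_self_of_subset_right (fun r hr => hr.1)] at h2
    exact h2
  · exact le_of_tendsto ((hcover s).integral_tendsto_of_countably_generated (hint s hs))
      ((hev s hs).mono fun j hj => hbd s hs j hj)

variable {E V : Type*} [NormedAddCommGroup E] [NormedAddCommGroup V]

/-- Up to each `t j` all trajectories lie in one ball, so a constant works locally in time.
Admissible constants form an upward closed, hence convex, set, so a partition of unity makes the
choice continuous. -/
theorem exists_continuousOn_lipschitz_majorant {f : E → V → E} (hf : LipschitzOnBalls f) (R : ℝ)
    {t : ℕ → ℝ} {x : ℕ → ℝ → E}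
    (hbd : ∀ j, ∃ M : ℝ, ∀ k, ∀ s ∈ Icc 0 (t j), ‖x k s‖ ≤ M) :
    ∃ ℓ : ℝ → ℝ, ContinuousOn ℓ (⋃ j, Iio (t j)) ∧ (∀ s, 0 ≤ ℓ s) ∧
      ∀ s ∈ gridTimes t, ∀ k v, ‖v‖ ≤ R → ∀ p ∈ closedBall (x k s) 1, ∀ q ∈ closedBall (x k s) 1,
        ‖f p v - f q v‖ ≤ ℓ s * ‖p - q‖ := by
  classical
  set I : Set ℝ := ⋃ j, Iio (t j) with hI
  -- The guard `0 ≤ s` makes negative times unconstrained, so that the index set is the open set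
  -- `I`.
  let C : ℝ → Set ℝ := fun s => {c | 0 ≤ c ∧ (0 ≤ s → ∀ k v, ‖v‖ ≤ R →
    ∀ p ∈ closedBall (x k s) 1, ∀ q ∈ closedBall (x k s) 1, ‖f p v - f q v‖ ≤ c * ‖p - q‖)}
  have hconv : ∀ s, Convex ℝ (C s) := by
    intro s
    suffices h : ∀ a ∈ C s, ∀ b, a ≤ b → b ∈ C s from
      OrdConnected.convex ⟨fun a ha _ _ b hb => h a ha b hb.1⟩
    intro a ha b hab
    refine ⟨ha.1.trans hab, fun hs k v hv p hp q hq => (ha.2 hs k v hv p hp q hq).trans ?_⟩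
    gcongr
  have hloc : ∀ s : I, ∃ c, ∀ᶠ r : I in 𝓝 s, c ∈ C (r : ℝ) := by
    rintro ⟨s, hs⟩
    obtain ⟨j, hj⟩ := mem_iUnion.1 hs
    obtain ⟨M, hM⟩ := hbd j
    obtain ⟨L, hL⟩ := hf (M + 1) R
    refine ⟨L, ?_⟩
    have hev : ∀ᶠ r : I in 𝓝 ⟨s, hs⟩, (r : ℝ) < t j :=
      (continuous_subtype_val.tendsto _).eventually_lt_const hj
    filter_upwards [hev] with r hr
    refine ⟨L.2, fun h0 k v hv p hp q hq => ?_⟩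
    have hx := hM k r ⟨h0, hr.le⟩
    have hmem : ∀ p ∈ closedBall (x k r) 1, p ∈ closedBall (0 : E) (M + 1) := by
      intro p hp
      rw [mem_closedBall_zero_iff]
      rw [mem_closedBall, dist_eq_norm] at hp
      have := norm_add_le (p - x k r) (x k r)
      rw [sub_add_cancel] at this
      linarith
    simpa [dist_eq_norm] using (hL v hv).dist_le_mul p (hmem p hp) q (hmem q hq)
  obtain ⟨g, hg⟩ := exists_continuous_forall_mem_convex_of_local_const
    (fun s : I => hconv s) hloc
  refine ⟨fun s => if h : s ∈ I then g ⟨s, h⟩ else 0, ?_, fun s => ?_, ?_⟩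
  · rw [continuousOn_iff_continuous_domRestrict]
    convert g.continuous using 1
    funext s
    simp only [domRestrict_apply]
    exact dif_pos s.2
  · dsimp only
    split_ifs with h
    · exact (hg ⟨s, h⟩).1
    · exact le_rfl
  · intro s hs
    have hs' : s ∈ I := hs.2
    simp only [dif_pos hs']
    exact (hg ⟨s, hs.2⟩).2 hs.1

end Weights

/-! ### Concatenating trajectories along a grid. -/

section Gluing

open Metric Filter

variable {E V : Type*} [NormedAddCommGroup E]

/-- Freezing the solution at negative times yields a function measurable on the whole line, as
gluing requires. -/
theorem SolvesOn.continuous_comp_max [NormedSpace ℝ E] {f : E → V → E} {w : ℝ → V} {x : ℝ → E}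
    (h : SolvesOn f w x (Ici 0)) : Continuous fun s => x (max s 0) := by
  have hc : ContinuousOn x (Ici 0) := by
    intro s hs
    have h1 := (h.mono Icc_subset_Ici_self).continuousOn (T := s + 1) s ⟨hs, by linarith⟩
    refine h1.mono_of_mem_nhdsWithin ?_
    filter_upwards [self_mem_nhdsWithin, mem_nhdsWithin_of_mem_nhds (Iio_mem_nhds (lt_add_one s))]
      with r hr hr'
    exact ⟨hr, le_of_lt hr'⟩
  exact hc.comp_continuous (continuous_id.max continuous_const) fun s => le_max_right s 0

theorem exists_mem_Ico_of_mem_gridTimes {t : ℕ → ℝ} (ht0 : t 0 = 0) {s : ℝ}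
    (hs : s ∈ gridTimes t) : ∃ j, s ∈ Ico (t j) (t (j + 1)) := by
  classical
  obtain ⟨h0, hj⟩ := mem_gridTimes.1 hs
  have hpos : Nat.find hj ≠ 0 := by
    intro h
    have := Nat.find_spec hj
    rw [h, ht0] at this
    exact absurd h0 (not_le.2 this)
  refine ⟨Nat.find hj - 1, not_lt.1 (Nat.find_min hj (Nat.sub_one_lt hpos)), ?_⟩
  rw [Nat.sub_one_add_one hpos]
  exact Nat.find_spec hj

theorem exists_measurable_glue {F : Type*} [MeasurableSpace F] {t : ℕ → ℝ} (ht : Monotone t)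
    {g : ℕ → ℝ → F} (hg : ∀ j, Measurable (g j)) :
    ∃ G : ℝ → F, Measurable G ∧ ∀ j, EqOn G (g j) (Ico (t j) (t (j + 1))) := by
  refine exists_measurable_piecewise _ (fun _ => measurableSet_Ico) g hg fun i j hij s hs => ?_
  exact absurd hs.2 (disjoint_left.1 (ht.pairwise_disjoint_on_Ico_succ hij) hs.1)

/-- Along a bounded sequence of functions one can select, for every grid interval, a member such
that consecutive members nearly agree at the common endpoint. -/
theorem exists_selection [ProperSpace E] {t : ℕ → ℝ} {x : ℕ → ℝ → E}
    (hbd : ∀ j, ∃ M : ℝ, ∀ k, ‖x k (t j)‖ ≤ M) {P : ℕ → ℕ → Prop}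
    (hP : ∀ j, ∀ᶠ k in atTop, P j k) {e : ℕ → ℝ} (he : ∀ j, 0 < e j) :
    ∃ κ : ℕ → ℕ, (∀ j, P j (κ j)) ∧
      ∀ j, ‖x (κ (j + 1)) (t (j + 1)) - x (κ j) (t (j + 1))‖ ≤ 2 * e (j + 1) := by
  choose M hM using hbd
  have hK : IsCompact (univ.pi fun j => closedBall (0 : E) (M j)) :=
    isCompact_univ_pi fun j => isCompact_closedBall _ _
  obtain ⟨a, _, φ, hφ, hlim⟩ := hK.tendsto_subseq (x := fun k j => x k (t j))
    fun k j _ => mem_closedBall_zero_iff.2 (hM j k)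
  have hlim' : ∀ j, ∀ᶠ m in atTop, dist (x (φ m) (t j)) (a j) < e j := fun j =>
    (tendsto_pi_nhds.1 hlim j).eventually (ball_mem_nhds _ (he j))
  have hex : ∀ j, ∃ m, P j (φ m) ∧ dist (x (φ m) (t j)) (a j) < e j ∧
      dist (x (φ m) (t (j + 1))) (a (j + 1)) < e (j + 1) := fun j =>
    ((hφ.tendsto_atTop.eventually (hP j)).and ((hlim' j).and (hlim' (j + 1)))).exists
  choose m hm using hex
  refine ⟨fun j => φ (m j), fun j => (hm j).1, fun j => ?_⟩
  rw [← dist_eq_norm]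
  have := dist_triangle_right (x (φ (m (j + 1))) (t (j + 1))) (x (φ (m j)) (t (j + 1))) (a (j + 1))
  linarith [(hm (j + 1)).2.1, (hm j).2.2]

variable [NormedSpace ℝ E] [ProperSpace E] [MeasurableSpace E] [BorelSpace E]
  [NormedAddCommGroup V] [MeasurableSpace V] [BorelSpace V] [SecondCountableTopology V]

/-- A sequence of trajectories that is bounded on every `[0, t j]` has members which, followed one
after the other along the grid, are shadowed by a single trajectory. -/
theorem exists_shadowing_trajectory {f : E → V → E} (hcont : Continuous (Function.uncurry f))
    (hf : LipschitzOnBalls f) {t : ℕ → ℝ} (ht : StrictMono t) (ht0 : t 0 = 0) {R : ℝ}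
    {U : ℕ → ℝ → V} (hUm : ∀ k, Measurable (U k)) (hUR : ∀ k s, ‖U k s‖ ≤ R)
    {x : ℕ → ℝ → E} (hx : ∀ k, SolvesOn f (U k) (x k) (Ici 0))
    (hbd : ∀ j, ∃ M : ℝ, ∀ k, ∀ s ∈ Icc 0 (t j), ‖x k s‖ ≤ M)
    {P : ℕ → ℕ → Prop} (hP : ∀ j, ∀ᶠ k in atTop, P j k) {η : ℝ} (hη : 0 < η) :
    ∃ (κ : ℕ → ℕ) (w : ℝ → V) (y : ℝ → E), (∀ j, P j (κ j)) ∧ Measurable w ∧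
      (∀ s, ‖w s‖ ≤ R) ∧ SolvesOn f w y (gridTimes t) ∧
      ∀ j, ∀ s ∈ Ico (t j) (t (j + 1)), ‖y s - x (κ j) s‖ ≤ η := by
  have htnn : ∀ j, 0 ≤ t j := fun j => ht0 ▸ ht.monotone (Nat.zero_le j)
  have htJ : ∀ j, t j ∈ gridTimes t := fun j =>
    mem_gridTimes.2 ⟨htnn j, j + 1, ht j.lt_succ_self⟩
  have hIJ : ∀ j, Ico (t j) (t (j + 1)) ⊆ gridTimes t := fun j s hs =>
    mem_gridTimes.2 ⟨(htnn j).trans hs.1, j + 1, hs.2⟩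
  obtain ⟨ℓ, hℓc, hℓ0, hℓ⟩ := exists_continuousOn_lipschitz_majorant hf R hbd
  -- The cap `1` keeps the shadowing solution in the unit balls where `ℓ` is a Lipschitz constant.
  obtain ⟨ρ, hρ0, hρη, hρanti, hρint, hρtail⟩ :=
    exists_weight ht ht0 hℓc hℓ0 (lt_min hη one_pos)
  obtain ⟨κ, hκP, hκ⟩ := exists_selection (x := x) (t := t) (P := P)
    (fun j => (hbd j).imp fun M hM k => hM k _ ⟨htnn j, le_rfl⟩) hP
    -- With this choice all jumps from `t (j + 1)` on sum to at most `ρ (t (j + 1)) / 2`, the error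
    -- that shadowing tolerates.
    (e := fun j => ρ (t j) * (1 / 2) ^ j / 4) (fun j => by have := hρ0 (t j); positivity)
  -- the jumps at the grid points and their tails
  let d : ℕ → E := fun j => x (κ (j + 1)) (t (j + 1)) - x (κ j) (t (j + 1))
  let S : ℕ → E := fun j => ∑' i, d (i + j)
  have hd : ∀ j i, ‖d (i + j)‖ ≤ ρ (t (j + 1)) / 4 * (1 / 2) ^ i := by
    intro j i
    refine (hκ (i + j)).trans ?_
    have h1 : ρ (t (i + j + 1)) ≤ ρ (t (j + 1)) :=
      hρanti (htJ _) (htJ _) (ht.monotone (by omega))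
    have h2 : (1 / 2 : ℝ) ^ (i + j) ≤ (1 / 2) ^ i :=
      pow_le_pow_of_le_one (by norm_num) (by norm_num) (by omega)
    have h3 : 2 * (ρ (t (i + j + 1)) * (1 / 2) ^ (i + j + 1) / 4) =
        ρ (t (i + j + 1)) / 4 * (1 / 2) ^ (i + j) := by rw [pow_succ]; ring
    rw [h3]
    have := hρ0 (t (j + 1))
    gcongr
  have hgeom : ∀ j, HasSum (fun i : ℕ => ρ (t (j + 1)) / 4 * (1 / 2) ^ i) (ρ (t (j + 1)) / 2) := by
    intro j
    have h : ρ (t (j + 1)) / 2 = ρ (t (j + 1)) / 4 * 2 := by ring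
    rw [h]
    exact hasSum_geometric_two.mul_left _
  have hsum : ∀ j, Summable fun i => d (i + j) := fun j =>
    Summable.of_norm_bounded (hgeom j).summable (hd j)
  have hSle : ∀ j, ‖S j‖ ≤ ρ (t (j + 1)) / 2 := fun j => tsum_of_norm_bounded (hgeom j) (hd j)
  have hSs : ∀ j, S j = d j + S (j + 1) := by
    intro j
    simp only [S]
    rw [(hsum j).tsum_eq_zero_add]
    simp only [zero_add, add_right_comm _ 1 j, add_assoc]
  -- the glued control and the glued (discontinuous and continuous) trajectories
  have hxm : ∀ k, Measurable fun s => x k (max s 0) := fun k =>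
    (hx k).continuous_comp_max.measurable
  obtain ⟨w', hw'm, hw'⟩ := exists_measurable_glue ht.monotone (fun j => hUm (κ j))
  obtain ⟨D, hDm, hD'⟩ := exists_measurable_glue ht.monotone (fun j => hxm (κ j))
  obtain ⟨G, hGm, hG'⟩ := exists_measurable_glue ht.monotone (fun j => (hxm (κ j)).add_const (S j))
  -- Off the grid times `w'` is arbitrary; zero there keeps the bound `R` global.
  let w : ℝ → V := (gridTimes t).indicator w'
  have hwm : Measurable w := hw'm.indicator (measurableSet_gridTimes t)
  have hw : ∀ j, ∀ s ∈ Ico (t j) (t (j + 1)), w s = U (κ j) s := fun j s hs => by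
    rw [← hw' j hs]; exact indicator_of_mem (hIJ j hs) _
  have hmax : ∀ j, ∀ s ∈ Ico (t j) (t (j + 1)), max s 0 = s := fun j s hs =>
    max_eq_left ((htnn j).trans hs.1)
  have hD : ∀ j, ∀ s ∈ Ico (t j) (t (j + 1)), D s = x (κ j) s := fun j s hs => by
    rw [hD' j hs]; simp only [hmax j s hs]
  have hG : ∀ j, ∀ s ∈ Ico (t j) (t (j + 1)), G s = x (κ j) s + S j := fun j s hs => by
    rw [hG' j hs]; simp only [hmax j s hs]
  have hwR : ∀ s, ‖w s‖ ≤ R := by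
    intro s
    by_cases hs : s ∈ gridTimes t
    · obtain ⟨j, hj⟩ := exists_mem_Ico_of_mem_gridTimes ht0 hs
      rw [hw j s hj]; exact hUR _ s
    · simp only [w, indicator_of_notMem hs, norm_zero]
      exact (norm_nonneg _).trans (hUR 0 0)
  -- The right endpoint is included: shifting by the sum of all future jumps cancels the jump of
  -- `D`, so `G` is continuous and a primitive across grid points.
  have hGcl : ∀ j, ∀ s ∈ Icc (t j) (t (j + 1)), G s = x (κ j) s + S j := by
    intro j s hs
    rcases hs.2.lt_or_eq with h | rfl
    · exact hG j s ⟨hs.1, h⟩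
    · rw [hG (j + 1) _ ⟨le_rfl, ht (j + 1).lt_succ_self⟩, hSs j]
      simp only [d]
      abel
  have hpiece : ∀ j, ∀ s ∈ Icc (t j) (t (j + 1)),
      IntervalIntegrable (fun r => f (D r) (w r)) volume (t j) s ∧
        G s - G (t j) = ∫ r in (t j)..s, f (D r) (w r) := by
    intro j s hs
    have hs0 : s ∈ Ici (0 : ℝ) := (htnn j).trans hs.1
    have hae : ∀ᵐ r, r ∈ uIoc (t j) s → f (x (κ j) r) (U (κ j) r) = f (D r) (w r) := by
      filter_upwards [Measure.ae_ne volume s] with r hr hr'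
      rw [uIoc_of_le hs.1] at hr'
      have hm : r ∈ Ico (t j) (t (j + 1)) :=
        ⟨hr'.1.le, (lt_of_le_of_ne hr'.2 hr).trans_le hs.2⟩
      rw [hD j r hm, hw j r hm]
    constructor
    · exact (((hx (κ j) _ (htnn j)).1.symm.trans (hx (κ j) s hs0).1)).congr_ae
        ((ae_restrict_iff' measurableSet_uIoc).2 hae)
    · rw [hGcl j s hs, hGcl j (t j) ⟨le_rfl, (ht j.lt_succ_self).le⟩, add_sub_add_right_eq_sub,
        (hx (κ j)).sub_eq (htnn j) hs0]
      exact intervalIntegral.integral_congr_ae hae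
  have hGi : ∀ j, IntervalIntegrable (fun r => f (D r) (w r)) volume 0 (t j) ∧
      G (t j) = G 0 + ∫ r in (0 : ℝ)..(t j), f (D r) (w r) := by
    intro j
    induction j with
    | zero => rw [ht0]; simp
    | succ j ih =>
      obtain ⟨h1, h2⟩ := hpiece j (t (j + 1)) ⟨(ht j.lt_succ_self).le, le_rfl⟩
      refine ⟨ih.1.trans h1, ?_⟩
      rw [← intervalIntegral.integral_add_adjacent_intervals ih.1 h1, ← h2, ← add_assoc, ← ih.2]
      abel
  obtain ⟨y, hyD, hy⟩ := exists_solvesOn_of_weight hcont (measurableSet_gridTimes t)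
    (fun s hs => ⟨hs.1, Icc_subset_gridTimes hs⟩) hwm hDm hGm (fun s _ => hℓ0 s)
    (fun s _ => (hρ0 s).le) (fun s hs => (hρη s hs).trans (min_le_right _ _)) hρint hρtail
    (fun s hs => by
      obtain ⟨j, hj⟩ := exists_mem_Ico_of_mem_gridTimes ht0 hs
      rw [hD j s hj]
      exact hℓ s hs (κ j) (w s) (hwR s))
    (fun s hs => by
      obtain ⟨j, hj⟩ := exists_mem_Ico_of_mem_gridTimes ht0 hs
      rw [hD j s hj, hG j s hj, add_sub_cancel_left]
      have := hρanti hs (htJ (j + 1)) hj.2.le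
      linarith [hSle j])
    (fun s hs => by
      obtain ⟨j, hj⟩ := exists_mem_Ico_of_mem_gridTimes ht0 hs
      obtain ⟨h1, h2⟩ := hpiece j s ⟨hj.1, hj.2.le⟩
      refine ⟨(hGi j).1.trans h1, ?_⟩
      rw [← intervalIntegral.integral_add_adjacent_intervals (hGi j).1 h1, ← h2, ← add_assoc,
        ← (hGi j).2]
      abel)
  refine ⟨κ, w, y, hκP, hwm, hwR, hy, fun j s hs => ?_⟩
  rw [← hD j s hs]
  exact ((hyD s (hIJ j hs)).trans (hρη s (hIJ j hs))).trans (min_le_left _ _)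

end Gluing

/-! ### Inputs in `L_∞` and boundedness of reachable sets. -/

section Reachability

open Metric Filter

theorem SolvesOn.congr_control {E V : Type*} [NormedAddCommGroup E] [NormedSpace ℝ E]
    {f : E → V → E} {w w' : ℝ → V} {x : ℝ → E} (h : SolvesOn f w x (Ici 0))
    (hw : ∀ᵐ s ∂(volume.restrict (Ici (0 : ℝ))), w s = w' s) : SolvesOn f w' x (Ici 0) := by
  intro t ht
  have hae : ∀ᵐ s, s ∈ uIoc 0 t → f (x s) (w s) = f (x s) (w' s) := by
    filter_upwards [(ae_restrict_iff' measurableSet_Ici).1 hw] with s hs hs'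
    rw [uIoc_of_le ht] at hs'
    rw [hs hs'.1.le]
  refine ⟨(h t ht).1.congr_ae ((ae_restrict_iff' measurableSet_uIoc).2 hae), ?_⟩
  rw [(h t ht).2]
  congr 1
  exact intervalIntegral.integral_congr_ae hae

variable {n m : ℕ}
  {f : EuclideanSpace ℝ (Fin n) → EuclideanSpace ℝ (Fin m) → EuclideanSpace ℝ (Fin n)}

theorem IsSolution.apply_zero {y : EuclideanSpace ℝ (Fin n)} {u : InputSpace m}
    {x : ℝ → EuclideanSpace ℝ (Fin n)} (h : IsSolution f y u x) : x 0 = y := by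
  simpa using (h.2 0 le_rfl).2

theorem IsSolution.solvesOn {y : EuclideanSpace ℝ (Fin n)} {u : InputSpace m}
    {x : ℝ → EuclideanSpace ℝ (Fin n)} (h : IsSolution f y u x) : SolvesOn f u x (Ici 0) := by
  intro t ht
  rw [h.apply_zero]
  exact h.2 t ht

/-- The earlier estimates use a bound at every time, so the input is set to zero on the null set
where the essential bound fails. -/
theorem InputSpace.exists_bounded_representative (u : InputSpace m) :
    ∃ U : ℝ → EuclideanSpace ℝ (Fin m), Measurable U ∧ (∀ s, ‖U s‖ ≤ ‖u‖) ∧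
      ∀ᵐ s ∂(volume.restrict (Ici (0 : ℝ))), u s = U s := by
  have hu : Measurable (u : ℝ → EuclideanSpace ℝ (Fin m)) := (Lp.stronglyMeasurable u).measurable
  refine ⟨{s | ‖u s‖ ≤ ‖u‖}.indicator u,
    hu.indicator (measurableSet_le hu.norm measurable_const), fun s => ?_, ?_⟩
  · by_cases hs : ‖u s‖ ≤ ‖u‖
    · rwa [indicator_of_mem (show s ∈ {s | ‖u s‖ ≤ ‖u‖} from hs)]
    · rw [indicator_of_notMem (show s ∉ {s | ‖u s‖ ≤ ‖u‖} from hs), norm_zero]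
      exact norm_nonneg _
  · have hae : ∀ᵐ s ∂(volume.restrict (Ici (0 : ℝ))), ‖u s‖ ≤ ‖u‖ := by
      filter_upwards [ae_le_eLpNormEssSup (f := (u : ℝ → EuclideanSpace ℝ (Fin m)))
        (μ := volume.restrict (Ici (0 : ℝ)))] with s hs
      rw [← eLpNorm_exponent_top, ← Lp.enorm_def] at hs
      simpa using (ENNReal.toReal_le_toReal enorm_ne_top enorm_ne_top).2 hs
    filter_upwards [hae] with s hs
    exact (indicator_of_mem (show s ∈ {s | ‖u s‖ ≤ ‖u‖} from hs) _).symm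

theorem InputSpace.exists_of_bounded {w : ℝ → EuclideanSpace ℝ (Fin m)} (hw : Measurable w) {R : ℝ}
    (hR : ∀ s, ‖w s‖ ≤ R) :
    ∃ u : InputSpace m, ‖u‖ ≤ R ∧ ∀ᵐ s ∂(volume.restrict (Ici (0 : ℝ))), u s = w s := by
  have hmem : MemLp w ∞ (volume.restrict (Ici (0 : ℝ))) :=
    memLp_top_of_bound hw.aestronglyMeasurable R (ae_of_all _ hR)
  refine ⟨hmem.toLp w, ?_, hmem.coeFn_toLp⟩
  rw [Lp.norm_toLp]
  refine ENNReal.toReal_le_of_le_ofReal ((norm_nonneg _).trans (hR 0)) ?_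
  exact eLpNormEssSup_le_of_ae_bound (ae_of_all _ hR)

theorem SolvesOn.exists_input_eqOn (hf : LipschitzOnBalls f)
    {t : ℕ → ℝ} {w : ℝ → EuclideanSpace ℝ (Fin m)} (hw : Measurable w) {R : ℝ}
    (hR : ∀ s, ‖w s‖ ≤ R) {y : ℝ → EuclideanSpace ℝ (Fin n)} (hy : SolvesOn f w y (gridTimes t)) :
    ∃ u : InputSpace m, ‖u‖ ≤ R ∧ ∀ x, IsSolution f (y 0) u x → EqOn y x (gridTimes t) := by
  obtain ⟨u, huR, hu⟩ := InputSpace.exists_of_bounded hw hR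
  refine ⟨u, huR, fun x hx s hs => ?_⟩
  exact SolvesOn.eqOn hf hR (hy.mono (Icc_subset_gridTimes hs))
    ((hx.solvesOn.congr_control hu).mono Icc_subset_Ici_self) hx.apply_zero.symm ⟨hs.1, le_rfl⟩

/-- Reachable sets of forward complete systems are bounded, uniformly on bounded sets of times,
initial states and inputs. -/
theorem ForwardComplete.bounded_reachability (hcont : Continuous (Function.uncurry f))
    (hf : LipschitzOnBalls f) (hfc : ForwardComplete f) (r R T : ℝ) :
    ∃ M : ℝ, ∀ (U : ℝ → EuclideanSpace ℝ (Fin m)) (x : ℝ → EuclideanSpace ℝ (Fin n)),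
      Measurable U → (∀ s, ‖U s‖ ≤ R) → SolvesOn f U x (Ici 0) → ‖x 0‖ ≤ r →
        ∀ s ∈ Icc 0 T, ‖x s‖ ≤ M := by
  by_contra hcon
  let Bdd : ℝ → Prop := fun T => ∃ M : ℝ, ∀ (U : ℝ → EuclideanSpace ℝ (Fin m))
    (x : ℝ → EuclideanSpace ℝ (Fin n)), Measurable U → (∀ s, ‖U s‖ ≤ R) →
      SolvesOn f U x (Ici 0) → ‖x 0‖ ≤ r → ∀ s ∈ Icc 0 T, ‖x s‖ ≤ M
  have hmono : ∀ {a b : ℝ}, a ≤ b → Bdd b → Bdd a := by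
    rintro a b hab ⟨M, hM⟩
    exact ⟨M, fun U x hU hUR hx hx0 s hs => hM U x hU hUR hx hx0 s ⟨hs.1, hs.2.trans hab⟩⟩
  obtain ⟨δ₀, hδ₀, hδ₀'⟩ := SolvesOn.exists_norm_le_add_one hcont r R
  have hBδ : Bdd δ₀ := ⟨r + 1, fun U x _ hUR hx hx0 s hs =>
    hδ₀' U x hUR hx 0 le_rfl hx0 s (by simpa using hs)⟩
  have hnB : ¬ Bdd T := hcon
  let B : Set ℝ := {a | Bdd a}
  have hBb : BddAbove B := ⟨T, fun a ha => by
    by_contra! h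
    exact hnB (hmono h.le ha)⟩
  -- Uniform bounds hold on `[0, a]` for `a < τ` and fail for `a > τ`. The case `a = τ` is
  -- undecided, so bad trajectories are taken on slightly longer intervals.
  set τ := sSup B with hτ
  have hτpos : 0 < τ := hδ₀.trans_le (le_csSup hBb hBδ)
  have hlt : ∀ a, a < τ → Bdd a := by
    intro a ha
    obtain ⟨b, hb, hab⟩ := exists_lt_of_lt_csSup ⟨δ₀, hBδ⟩ ha
    exact hmono hab.le hb
  have hgt : ∀ a, τ < a → ¬ Bdd a := fun a ha h => absurd (le_csSup hBb h) (not_le.2 ha)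
  have hex : ∀ k : ℕ, ∃ (U : ℝ → EuclideanSpace ℝ (Fin m)) (x : ℝ → EuclideanSpace ℝ (Fin n)),
      Measurable U ∧ (∀ s, ‖U s‖ ≤ R) ∧ SolvesOn f U x (Ici 0) ∧ ‖x 0‖ ≤ r ∧
        ∃ s ∈ Icc 0 (τ + 1 / ((k : ℝ) + 1)), (k : ℝ) < ‖x s‖ := by
    intro k
    have h1 : (0 : ℝ) < 1 / ((k : ℝ) + 1) := by positivity
    have h := hgt (τ + 1 / ((k : ℝ) + 1)) (by linarith)
    by_contra! h'
    exact h ⟨k, fun U x hU hUR hx hx0 s hs => h' U x hU hUR hx hx0 s hs⟩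
  choose U x hUm hUR hx hx0 σ hσ hσk using hex
  let t : ℕ → ℝ := fun j => τ * (1 - 1 / ((j : ℝ) + 1))
  have ht0 : t 0 = 0 := by simp [t]
  have ht : StrictMono t := by
    intro i j hij
    have hij' : (i : ℝ) < j := by exact_mod_cast hij
    have : 1 / ((j : ℝ) + 1) < 1 / ((i : ℝ) + 1) :=
      one_div_lt_one_div_of_lt (by positivity) (by linarith)
    exact mul_lt_mul_of_pos_left (by linarith) hτpos
  have htτ : ∀ j, t j < τ := by
    intro j
    have : (0 : ℝ) < τ * (1 / ((j : ℝ) + 1)) := by positivity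
    simp only [t, mul_sub, mul_one]
    linarith
  have hinv : Tendsto (fun j : ℕ => 1 / ((j : ℝ) + 1)) atTop (𝓝 0) :=
    tendsto_one_div_add_atTop_nhds_zero_nat
  have htlim : Tendsto t atTop (𝓝 τ) := by simpa [t] using (hinv.const_sub 1).const_mul τ
  choose M hM using fun j => hlt (t j) (htτ j)
  obtain ⟨κ, w, y, hκ, hwm, hwR, hy, hyx⟩ := exists_shadowing_trajectory hcont hf ht ht0 hUm hUR hx
    (fun j => ⟨M j, fun k => hM j (U k) (x k) (hUm k) (hUR k) (hx k) (hx0 k)⟩)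
    -- `M j ≤ k` prevents the norm from exceeding `k` before `t j`; `j ≤ k` places the excess before
    -- `τ + 1 / (j + 1)`.
    (P := fun j k => M j ≤ k ∧ j ≤ k)
    (fun j => (tendsto_natCast_atTop_atTop.eventually_ge_atTop (M j)).and (eventually_ge_atTop j))
    one_pos
  obtain ⟨u, _, hu⟩ := hy.exists_input_eqOn hf hwm hwR
  -- Forward completeness carries the shadowing solution continuously through `τ`. So the selected
  -- trajectories are bounded at `t j`, and cannot become large in the short time left.
  obtain ⟨z, hz⟩ := hfc (y 0) u
  obtain ⟨K, hK⟩ := isCompact_Icc.exists_bound_of_continuousOn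
    (hz.1.mono (Icc_subset_Ici_self : Icc 0 τ ⊆ Ici 0))
  have htnn : ∀ j, 0 ≤ t j := fun j => ht0 ▸ ht.monotone (Nat.zero_le j)
  have hxK : ∀ j, ‖x (κ j) (t j)‖ ≤ K + 1 := by
    intro j
    have hj : t j ∈ gridTimes t := mem_gridTimes.2 ⟨htnn j, j + 1, ht j.lt_succ_self⟩
    have h1 := hyx j (t j) ⟨le_rfl, ht j.lt_succ_self⟩
    have h2 := hK (t j) ⟨htnn j, (htτ j).le⟩
    rw [← hu z hz hj] at h2
    have h3 := norm_sub_norm_le (x (κ j) (t j)) (y (t j))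
    rw [norm_sub_rev] at h3
    linarith
  obtain ⟨δ, hδ, hδ'⟩ := SolvesOn.exists_norm_le_add_one hcont (K + 1) R
  have hev : ∀ᶠ j : ℕ in atTop, τ + 1 / ((j : ℝ) + 1) - t j < δ := by
    have : Tendsto (fun j : ℕ => τ + 1 / ((j : ℝ) + 1) - t j) atTop (𝓝 0) := by
      simpa using (hinv.const_add τ).sub htlim
    exact this.eventually_lt_const hδ
  obtain ⟨j, hj1, hj2⟩ := (hev.and
    (tendsto_natCast_atTop_atTop.eventually_ge_atTop (K + 1 + 1))).exists
  have hjκ : (j : ℝ) ≤ κ j := by exact_mod_cast (hκ j).2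
  rcases le_total (σ (κ j)) (t j) with h | h
  · have := hM j (U (κ j)) (x (κ j)) (hUm _) (hUR _) (hx _) (hx0 _) (σ (κ j)) ⟨(hσ (κ j)).1, h⟩
    linarith [(hκ j).1, hσk (κ j)]
  · have h1 : 1 / ((κ j : ℝ) + 1) ≤ 1 / ((j : ℝ) + 1) :=
      one_div_le_one_div_of_le (by positivity) (by linarith)
    have := hδ' (U (κ j)) (x (κ j)) (hUR _) (hx _) (t j) (htnn j) (hxK j) (σ (κ j))
      ⟨h, by linarith [(hσ (κ j)).2]⟩
    linarith [hσk (κ j)]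

end Reachability

/-! ### From LIM to ULIM. -/

section Main

open Metric Filter

theorem HasULIM.hasLIM {X 𝒰 : Type*} [NormedAddCommGroup X] [NormedAddCommGroup 𝒰]
    {φ : ℝ → X → 𝒰 → X} (h : HasULIM φ) : HasLIM φ := by
  obtain ⟨γ, hγ, hφ⟩ := h
  refine ⟨γ, hγ, fun x u ε hε => ?_⟩
  obtain ⟨τ, hτ⟩ := hφ ε (‖x‖ + 1) hε (by positivity)
  obtain ⟨t, ht, _, hle⟩ := hτ x (by linarith) u
  exact ⟨t, ht, hle⟩

theorem ClassK.continuous_monotone {γ : ℝ≥0 → ℝ≥0} (hγ : ClassK γ ∨ γ = 0) :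
    Continuous γ ∧ Monotone γ ∧ γ 0 = 0 := by
  rcases hγ with h | rfl
  · exact ⟨h.1, h.2.1.monotone, h.2.2⟩
  · exact ⟨continuous_const, monotone_const, rfl⟩

variable {n m : ℕ}
  {f : EuclideanSpace ℝ (Fin n) → EuclideanSpace ℝ (Fin m) → EuclideanSpace ℝ (Fin n)}

theorem transitionMap_isSolution (hfc : ForwardComplete f) (y : EuclideanSpace ℝ (Fin n))
    (u : InputSpace m) : IsSolution f y u (fun t => transitionMap hfc t y u) :=
  (hfc y u).choose_spec

/-- If the trajectories of bounded initial states `y k` under the inputs `u k` of norm at most `R`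
stay outside the ball of radius `c` on `[0, k]`, there is an input of norm at most `R` with a
trajectory which stays outside any smaller ball forever. -/
theorem exists_trajectory_avoiding_ball (hcont : Continuous (Function.uncurry f))
    (hf : LipschitzOnBalls f) (hfc : ForwardComplete f) {r R c η : ℝ} (hη : 0 < η)
    {y : ℕ → EuclideanSpace ℝ (Fin n)} {u : ℕ → InputSpace m} (hy : ∀ k, ‖y k‖ ≤ r)
    (hu : ∀ k, ‖u k‖ ≤ R)
    (hc : ∀ k : ℕ, ∀ t ∈ Icc (0 : ℝ) k, c ≤ ‖transitionMap hfc t (y k) (u k)‖) :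
    ∃ (z : EuclideanSpace ℝ (Fin n)) (v : InputSpace m), ‖v‖ ≤ R ∧
      ∀ t, 0 ≤ t → c - η ≤ ‖transitionMap hfc t z v‖ := by
  choose U hUm hUu hU using fun k => InputSpace.exists_bounded_representative (u k)
  have hUR : ∀ k s, ‖U k s‖ ≤ R := fun k s => (hUu k s).trans (hu k)
  have hsol := fun k => transitionMap_isSolution hfc (y k) (u k)
  have hx : ∀ k, SolvesOn f (U k) (fun t => transitionMap hfc t (y k) (u k)) (Ici 0) := fun k =>
    (hsol k).solvesOn.congr_control (hU k)
  have hbd : ∀ j : ℕ, ∃ M : ℝ, ∀ k, ∀ s ∈ Icc (0 : ℝ) j,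
      ‖transitionMap hfc s (y k) (u k)‖ ≤ M := by
    intro j
    obtain ⟨M, hM⟩ := hfc.bounded_reachability hcont hf r R j
    exact ⟨M, fun k => hM (U k) _ (hUm k) (hUR k) (hx k)
      (by rw [(hsol k).apply_zero]; exact hy k)⟩
  obtain ⟨κ, w, p, hκ, hwm, hwR, hp, hpx⟩ := exists_shadowing_trajectory hcont hf
    (t := fun j : ℕ => (j : ℝ)) Nat.strictMono_cast Nat.cast_zero hUm hUR hx hbd
    -- Member `κ j` is followed on `[j, j + 1)`, which must lie in its avoidance interval `[0, κ
    -- j]`.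
    (P := fun j k => j + 1 ≤ k) (fun j => eventually_ge_atTop (j + 1)) hη
  obtain ⟨v, hvR, hv⟩ := hp.exists_input_eqOn hf hwm hwR
  refine ⟨p 0, v, hvR, fun t ht => ?_⟩
  have htJ : t ∈ gridTimes (fun j : ℕ => (j : ℝ)) := mem_gridTimes.2 ⟨ht, exists_nat_gt t⟩
  obtain ⟨j, hj⟩ := exists_mem_Ico_of_mem_gridTimes Nat.cast_zero htJ
  have h1 := hpx j t hj
  rw [hv _ (transitionMap_isSolution hfc (p 0) v) htJ] at h1
  have h2 := hc (κ j) t ⟨ht, hj.2.le.trans (by exact_mod_cast hκ j)⟩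
  have h3 := norm_sub_norm_le (transitionMap hfc t (y (κ j)) (u (κ j))) (transitionMap hfc t (p 0) v)
  rw [norm_sub_rev] at h3
  linarith

end Main

theorem mainTheorem7 (n m : ℕ)
    (f : EuclideanSpace ℝ (Fin n) → EuclideanSpace ℝ (Fin m) → EuclideanSpace ℝ (Fin n))
    (hcont : Continuous (Function.uncurry f))
    (hlip : LocallyLipschitzInState f)
    (hfc : ForwardComplete f) :
    HasLIM (transitionMap hfc) ↔ HasULIM (transitionMap hfc) := by
  refine ⟨?_, HasULIM.hasLIM⟩
  rintro ⟨γ, hγ, hlim⟩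
  obtain ⟨hγc, hγm, hγ0⟩ := ClassK.continuous_monotone hγ
  have hf : LipschitzOnBalls f := lipschitzOnBalls_of_locally hcont hlip
  -- The extra `s` makes violation at time `0` force `‖u‖ < r`, even if `γ` is bounded or zero.
  refine ⟨fun s => γ s + s, Or.inl ⟨hγc.add continuous_id, hγm.add_strictMono strictMono_id,
    by simp [hγ0]⟩, fun ε r hε hr => ?_⟩
  by_contra! hcon
  choose y hy u hyu using fun k : ℕ => hcon k
  -- the inputs are bounded, because the initial states violate the estimate
  have hur : ∀ k, ‖u k‖₊ ∈ Icc (0 : ℝ≥0) r.toNNReal := by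
    intro k
    have h := hyu k 0 le_rfl k.cast_nonneg
    rw [(transitionMap_isSolution hfc (y k) (u k)).apply_zero] at h
    push_cast at h
    refine ⟨zero_le, ?_⟩
    rw [← NNReal.coe_le_coe, Real.coe_toNNReal r hr.le, coe_nnnorm]
    have := (γ ‖u k‖₊).coe_nonneg
    linarith [hy k]
  obtain ⟨c, _, ψ, hψ, hc⟩ := isCompact_Icc.tendsto_subseq hur
  have hγR : Continuous fun s : ℝ≥0 => (γ s : ℝ) := NNReal.continuous_coe.comp hγc
  have hnear : ∀ᶠ s in 𝓝 c, (γ s : ℝ) < γ c + ε / 8 :=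
    hγR.continuousAt.eventually_lt_const (by linarith)
  obtain ⟨R, hcR, hR⟩ := hnear.exists_gt
  have hev : ∀ᶠ k in Filter.atTop, ‖u (ψ k)‖₊ < R ∧ (γ c : ℝ) - ε / 8 < γ ‖u (ψ k)‖₊ :=
    (hc.eventually_lt_const hcR).and
      (((hγR.tendsto c).comp hc).eventually_const_lt (by linarith))
  obtain ⟨N, hN⟩ := Filter.eventually_atTop.1 hev
  -- The trajectories stay above `ε + γ c - ε / 8`, and shadowing costs another `ε / 8`. LIM with `ε
  -- / 2` gives a value below `γ c + 5 * ε / 8`, contradicting the bound `γ c + 6 * ε / 8`.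
  obtain ⟨z, v, hv, hz⟩ := exists_trajectory_avoiding_ball hcont hf hfc (r := r) (R := R)
    (c := 7 * ε / 8 + γ c) (η := ε / 8) (by linarith)
    (y := fun k => y (ψ (k + N))) (u := fun k => u (ψ (k + N))) (fun k => hy _)
    (fun k => (NNReal.coe_le_coe.2 (hN (k + N) (Nat.le_add_left N k)).1.le))
    (fun k t ht => by
      have hk : (k : ℝ) ≤ ψ (k + N) := by
        exact_mod_cast (Nat.le_add_right k N).trans (hψ.id_le (k + N))
      have h1 := hyu (ψ (k + N)) t ht.1 (ht.2.trans hk)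
      have h2 := (hN (k + N) (Nat.le_add_left N k)).2
      push_cast at h1
      linarith [norm_nonneg (u (ψ (k + N)))])
  obtain ⟨t, ht, hle⟩ := hlim z v (ε / 2) (by linarith)
  have h1 : (γ ‖v‖₊ : ℝ) ≤ γ R := NNReal.coe_le_coe.2 (hγm (NNReal.coe_le_coe.1 hv))
  linarith [hz t ht]
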